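/- For $n\ge 0$, a code of length $n$ is a nonempty set $\mathcal C\subseteq\mathbb F_2^n$ together with a (possibly randomized) decoder $\phi:\mathbb F_2^n\to\mathcal C$; its rate is $\frac1n\log_2|\mathcal C|$. A memoryless adversary strategy of length $n$ is an $n$-tuple of jointly distributed random functions $f^i:\mathbb F_2\to\mathbb F_2$ (possibly dependent on each other, independent of the transmitted codeword and of the decoder's randomness). If $\mathbf x\in\mathcal C$ is sent, the error vector is $f(\mathbf x)=(f^1(x_1),\dots,f^n(x_n))$ and $\mathbf x+f(\mathbf x)$ is received; the average error probability is $P(\mathcal C,f)=\frac1{|\mathcal C|}\sum_{\mathbf x\in\mathcal C}\Pr(\phi(\mathbf x+f(\mathbf x))\ne\mathbf x)$. Let $(\mathcal C_n)_n$ be a family of codes, $\mathcal C_n$ of length $n$. A family $(f_n)_n$ of strategies, which may depend on the codes, is strongly-$p$-limited for $(\mathcal C_n)$ if for every $\epsilon>0$, with $\mathbf x$ uniform on $\mathcal C_n$, $\Pr(\mathrm{wt}(f_n(\mathbf x))/n<p+\epsilon)\to1$ as $n\to\infty$, where $\mathrm{wt}$ is the Hamming weight. For $\epsilon>0$ call $(\mathcal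 C_n)$ $\epsilon$-good if for every strongly-$p$-limited $(f_n)$ one has $P(\mathcal C_n,f_n)\le\epsilon$ for all sufficiently large $n$. The capacity of the strongly-$p$-limited memoryless adversary is $$C_s(p)=\inf_{\epsilon>0}\ \sup_{(\mathcal C_n)\ \epsilon\text{-good}}\ \limsup_{n\to\infty}\frac{\log_2|\mathcal C_n|}{n}.$$ Let $h_B(x)=-x\log_2x-(1-x)\log_2(1-x)$. **Theorem.** If $0\le p\le\frac14$, then $C_s(p)\le 1-h_B(p)$. If $\frac14<p\le\frac12$, then $C_s(p)\le h_B(1-3p+4p^2)-h_B(p)$. Moreover, for $\frac14<p<\frac12$ this last bound is strictly below $1-h_B(p)$ (the well-known value of the capacity of the binary symmetric channel with crossover probability $p$): $h_B(1-3p+4p^2)-h_B(p)<1-h_B(p)$. -/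

import Mathlib

open Filter

noncomputable section

/-- The Hamming space `𝔽₂ⁿ`. -/
abbrev Word (n : ℕ) : Type := Fin n → ZMod 2

/-- The binary entropy function, in bits. -/
def hB (x : ℝ) : ℝ := Real.binEntropy x / Real.log 2

/-- A (nonempty) binary code of length `n`, together with its associated, possibly randomized,
decoder `φ : 𝔽₂ⁿ → 𝒞`. -/
structure Code (n : ℕ) where
  words : Finset (Word n)
  nonempty : words.Nonempty
  decoder : Word n → PMF words

/-- A memoryless adversary strategy: `n` random functions `fⁱ : 𝔽₂ → 𝔽₂`, given by their joint
law (the functions may share randomness; they are independent of the transmitted codeword and of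
the decoder). -/
abbrev Strategy (n : ℕ) : Type := PMF (Fin n → ZMod 2 → ZMod 2)

/-- The error vector `e`, with `eᵢ = fⁱ(xᵢ)`. -/
def errorVector {n : ℕ} (f : Fin n → ZMod 2 → ZMod 2) (x : Word n) : Word n :=
  fun i => f i (x i)

/-- `Pr(wt(e)/n < t)`, for a uniformly random codeword of `C` and the strategy `ν`. -/
def probWeightLT {n : ℕ} (C : Code n) (ν : Strategy n) (t : ℝ) : ℝ :=
  (1 / (C.words.card : ℝ)) * ∑ x ∈ C.words, ∑ f : Fin n → ZMod 2 → ZMod 2,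
    if (hammingNorm (errorVector f x) : ℝ) / n < t then (ν f).toReal else 0

/-- The average probability of error
`(1/|𝒞|) ∑_{x ∈ 𝒞} Pr(φ(x + f(x)) ≠ x)` under the strategy `ν`. -/
def avgError {n : ℕ} (C : Code n) (ν : Strategy n) : ℝ :=
  (1 / (C.words.card : ℝ)) * ∑ x : C.words, ∑ f : Fin n → ZMod 2 → ZMod 2,
    (ν f).toReal * (1 - (C.decoder (x.1 + errorVector f x.1) x).toReal)

/-- The strategies `ν` (one for each length) form a strongly-`p`-limited adversary for the code
family `C`: for all `ε > 0`, `Pr(wt(e)/n < p + ε) = 1 - o(1)`. -/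
def StronglyLimited (C : ∀ n, Code n) (p : ℝ) (ν : ∀ n, Strategy n) : Prop :=
  ∀ ε : ℝ, 0 < ε → Tendsto (fun n => probWeightLT (C n) (ν n) (p + ε)) atTop (nhds 1)

/-- The code family `C` has average error probability at most `ε`, for large lengths, against
every strongly-`p`-limited adversary. -/
def IsGood (p ε : ℝ) (C : ∀ n, Code n) : Prop :=
  ∀ ν : ∀ n, Strategy n, StronglyLimited C p ν → ∀ᶠ n in atTop, avgError (C n) (ν n) ≤ ε

/-- The rate `log₂ |𝒞| / n`. -/
def rate {n : ℕ} (C : Code n) : ℝ := Real.logb 2 (C.words.card : ℝ) / n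

/-- The capacity `C_s(p)` of the strongly-`p`-limited memoryless adversary: the infimum over
`ε > 0` of the largest asymptotic rate `limsup_n log₂ |𝒞ₙ| / n` of a code family whose error
probability is at most `ε`. -/
def strongCapacity (p : ℝ) : EReal :=
  ⨅ (ε : ℝ) (_ : 0 < ε), ⨆ (C : ∀ n, Code n) (_ : IsGood p ε C),
    limsup (fun n => ((rate (C n) : ℝ) : EReal)) atTop

end

/-!
Against a good code the adversary may first imitate a binary symmetric channel with crossover
probability `p`. A typical noise word has probability about `exp (-n H(p))`, so if a positive
fraction of the codewords is sent into a set `T` with probability at least a positive constant, then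
up to subexponential factors `|C| ≤ |T| exp (-n H(p))`. It remains to find a small `T`.

Call a codeword central if only a vanishing fraction of the code lies at distance more than `2pn`
from it. If at least half of the codewords were central, the adversary could overwrite a random half
of the transmitted bits by those of a random central codeword `x'`: this changes about half of the
positions in which `x` and `x'` differ, hence rarely more than `pn`, and for two central codewords
the decoder cannot tell which was sent and which was used for overwriting.

So at least half of the codewords `d` have a positive fraction of the code at distance more than
`2pn`, and by double counting boundedly many such `d` account for a quarter of the code. The noise
moves a word at distance more than `2pn` from `d` to distance at least about `(p + (1 - 2p) 2p) n`,
that is `(3p - 4p²) n`. Hence `T` can be taken as a union of boundedly many complements of balls of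
that radius, and `|T|` is about `exp (n H(max (1/2) (3p - 4p²)))`.
-/

section

open MeasureTheory ProbabilityTheory unitInterval Topology

section Concentration

theorem one_sub_variance_div_sq_le_measureReal {Ω : Type*} [MeasurableSpace Ω] {μ : Measure Ω}
    [IsProbabilityMeasure μ] {X : Ω → ℝ} (hX : MemLp X 2 μ) {c : ℝ} (hc : 0 < c) :
    1 - variance X μ / c ^ 2 ≤ μ.real {ω | |X ω - μ[X]| < c} := by
  have hcheb : μ.real {ω | c ≤ |X ω - μ[X]|} ≤ variance X μ / c ^ 2 :=
    ENNReal.toReal_le_of_le_ofReal (div_nonneg (variance_nonneg X μ) (sq_nonneg c))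
      (meas_ge_le_variance_div_sq hX hc)
  have hcover : {ω | |X ω - μ[X]| < c} ∪ {ω | c ≤ |X ω - μ[X]|} = Set.univ :=
    Set.eq_univ_of_forall fun ω => by simp only [Set.mem_union, Set.mem_ofPred_eq, lt_or_ge]
  have hunion := measureReal_union_le (μ := μ) {ω | |X ω - μ[X]| < c} {ω | c ≤ |X ω - μ[X]|}
  rw [hcover, probReal_univ] at hunion
  linarith

theorem one_sub_le_pi_real_abs_sum_sub_lt {ι : Type*} [Fintype ι] {Ω : ι → Type*}
    [∀ i, MeasurableSpace (Ω i)] {μ : ∀ i, Measure (Ω i)} [∀ i, IsProbabilityMeasure (μ i)]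
    {X : ∀ i, Ω i → ℝ} {a b : ι → ℝ} (hX : ∀ i, AEMeasurable (X i) (μ i))
    (hab : ∀ i, ∀ᵐ ω ∂μ i, X i ω ∈ Set.Icc (a i) (b i)) {c : ℝ} (hc : 0 < c) :
    1 - (∑ i, ((b i - a i) / 2) ^ 2) / c ^ 2 ≤
      (Measure.pi μ).real {ω | |∑ i, X i (ω i) - ∑ i, ∫ x, X i x ∂μ i| < c} := by
  have hLp (i : ι) : MemLp (X i) 2 (μ i) := memLp_of_bounded (hab i) (hX i).aestronglyMeasurable 2
  have hLp' (i : ι) : MemLp (fun ω : ∀ j, Ω j => X i (ω i)) 2 (Measure.pi μ) :=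
    (hLp i).comp_measurePreserving (measurePreserving_eval μ i)
  have hmean : ∫ ω, ∑ i, X i (ω i) ∂Measure.pi μ = ∑ i, ∫ x, X i x ∂μ i := by
    rw [integral_finsetSum _ fun i _ => (hLp' i).integrable one_le_two]
    exact Finset.sum_congr rfl fun i _ => integral_comp_eval (hX i).aestronglyMeasurable
  have hvar : variance (fun ω => ∑ i, X i (ω i)) (Measure.pi μ) ≤ ∑ i, ((b i - a i) / 2) ^ 2 :=
    calc variance (fun ω => ∑ i, X i (ω i)) (Measure.pi μ)
        = ∑ i, variance (X i) (μ i) := by rw [← variance_sum_pi hLp, Finset.sum_fn]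
      _ ≤ ∑ i, ((b i - a i) / 2) ^ 2 :=
          Finset.sum_le_sum fun i _ => variance_le_sq_of_bounded (hab i) (hX i)
  rw [← hmean]
  refine le_trans ?_ (one_sub_variance_div_sq_le_measureReal
    (memLp_finsetSum _ fun i _ => hLp' i) hc)
  gcongr

end Concentration

section FinitePMF

variable {α β : Type*} [Fintype α] [Fintype β]

theorem sum_toReal_eq_one (q : PMF α) : ∑ a, (q a).toReal = 1 := by
  rw [← ENNReal.toReal_sum fun a _ => q.apply_ne_top a, ← tsum_fintype (L := .unconditional _),
    q.tsum_coe, ENNReal.toReal_one]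

theorem toMeasure_real_eq_sum [MeasurableSpace α] [MeasurableSingletonClass α] (q : PMF α)
    (s : Set α) : q.toMeasure.real s = ∑ a, (q a).toReal * s.indicator 1 a := by
  rw [Measure.real, q.toMeasure_apply_fintype s, ENNReal.toReal_sum fun a _ =>
    ne_top_of_le_ne_top (q.apply_ne_top a) (Set.indicator_le_self _ _ a)]
  refine Finset.sum_congr rfl fun a _ => ?_
  by_cases ha : a ∈ s <;> simp [ha]

theorem sum_bind_toReal_mul (q : PMF α) (k : α → PMF β) (g : β → ℝ) :
    ∑ b, (q.bind k b).toReal * g b = ∑ a, (q a).toReal * ∑ b, (k a b).toReal * g b := by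
  have hbind (b : β) : (q.bind k b).toReal = ∑ a, (q a).toReal * (k a b).toReal := by
    rw [PMF.bind_apply, tsum_fintype, ENNReal.toReal_sum fun a _ =>
      ENNReal.mul_ne_top (q.apply_ne_top a) ((k a).apply_ne_top b)]
    simp only [ENNReal.toReal_mul]
  simp only [hbind, Finset.sum_mul, Finset.mul_sum, mul_assoc]
  exact Finset.sum_comm

theorem sum_map_toReal_mul (q : PMF α) (f : α → β) (g : β → ℝ) :
    ∑ b, (q.map f b).toReal * g b = ∑ a, (q a).toReal * g (f a) := by
  classical
  rw [PMF.map, sum_bind_toReal_mul]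
  simp [PMF.pure_apply, apply_ite ENNReal.toReal]

end FinitePMF

section Strategies

variable {n : ℕ}

/-- The probability that the decoder of `C` does not answer `x` when `y` is received. -/
noncomputable def Code.missProb (C : Code n) (y : Word n) (x : C.words) : ℝ :=
  1 - (C.decoder y x).toReal

theorem Code.missProb_nonneg (C : Code n) (y : Word n) (x : C.words) : 0 ≤ C.missProb y x :=
  sub_nonneg.2 (ENNReal.toReal_le_of_le_ofReal zero_le_one
    (by simpa using (C.decoder y).coe_le_one x))

theorem Code.card_pos (C : Code n) : (0 : ℝ) < C.words.card :=
  Nat.cast_pos.2 C.nonempty.card_pos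

variable {α : Type*} (C : Code n) (q : PMF α)

theorem probWeightLT_eq_sum_toMeasure_real (ν : Strategy n) (t : ℝ) :
    probWeightLT C ν t = 1 / (C.words.card : ℝ) * ∑ x ∈ C.words,
      ν.toMeasure.real {f | (hammingNorm (errorVector f x) : ℝ) / n < t} := by
  classical
  simp only [toMeasure_real_eq_sum, Set.indicator_apply, Pi.one_apply, mul_boole]
  rfl

theorem probWeightLT_le_one (ν : Strategy n) (t : ℝ) : probWeightLT C ν t ≤ 1 := by
  rw [probWeightLT_eq_sum_toMeasure_real, one_div_mul_eq_div, div_le_one C.card_pos]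
  exact (Finset.sum_le_card_nsmul _ _ 1 fun x _ => measureReal_le_one).trans_eq (nsmul_one _)

theorem StronglyLimited.of_le {C : ∀ n, Code n} {p : ℝ} {ν : ∀ n, Strategy n}
    (h : ∀ ε : ℝ, 0 < ε → ∃ u : ℕ → ℝ, Tendsto u atTop (𝓝 1) ∧
      ∀ᶠ n in atTop, u n ≤ probWeightLT (C n) (ν n) (p + ε)) :
    StronglyLimited C p ν := fun ε hε =>
  have ⟨_, hu, hle⟩ := h ε hε
  tendsto_of_tendsto_of_tendsto_of_le_of_le' hu tendsto_const_nhds hle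
    (Eventually.of_forall fun n => probWeightLT_le_one (C n) (ν n) (p + ε))

theorem probWeightLT_map [MeasurableSpace α] [DiscreteMeasurableSpace α]
    (F : α → Fin n → ZMod 2 → ZMod 2) (t : ℝ) :
    probWeightLT C (q.map F) t = 1 / (C.words.card : ℝ) * ∑ x ∈ C.words,
      q.toMeasure.real {a | (hammingNorm (errorVector (F a) x) : ℝ) / n < t} := by
  simp only [probWeightLT_eq_sum_toMeasure_real, ← q.toMeasure_map F .of_discrete,
    map_measureReal_apply Measurable.of_discrete MeasurableSet.of_discrete, Set.preimage_ofPred_eq]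

variable [Fintype α]

theorem avgError_map (F : α → Fin n → ZMod 2 → ZMod 2) :
    avgError C (q.map F) = 1 / (C.words.card : ℝ) *
      ∑ x : C.words, ∑ a, (q a).toReal * C.missProb (x.1 + errorVector (F a) x.1) x := by
  simp only [avgError, sum_map_toReal_mul, Code.missProb]

theorem avgError_bind (k : α → Strategy n) :
    avgError C (q.bind k) = ∑ a, (q a).toReal * avgError C (k a) := by
  simp only [avgError, sum_bind_toReal_mul, Finset.mul_sum, mul_left_comm]
  rw [Finset.sum_comm]

theorem probWeightLT_bind (k : α → Strategy n) (t : ℝ) :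
    probWeightLT C (q.bind k) t = ∑ a, (q a).toReal * probWeightLT C (k a) t := by
  simp only [probWeightLT_eq_sum_toMeasure_real, toMeasure_real_eq_sum, sum_bind_toReal_mul,
    Finset.mul_sum, mul_left_comm]
  rw [Finset.sum_comm]

end Strategies

section BinarySymmetricNoise

variable {n : ℕ}

/-- The law of the noise of `n` independent uses of the binary symmetric channel with crossover
probability `p`. -/
noncomputable def bscNoise (p : I) (n : ℕ) : PMF (Word n) :=
  (Measure.pi fun _ => bernoulliMeasure (1 : ZMod 2) 0 p).toPMF

theorem bscNoise_apply_toReal (p : I) (e : Word n) :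
    (bscNoise p n e).toReal = (p : ℝ) ^ hammingNorm e * (1 - p : ℝ) ^ (n - hammingNorm e) := by
  have hcoord (a : ZMod 2) : (bernoulliMeasure (1 : ZMod 2) 0 p).real {a} =
      if a ≠ 0 then (p : ℝ) else 1 - p := by
    rw [bernoulliMeasure_real_apply p (measurableSet_singleton _)]
    obtain rfl | rfl : a = 0 ∨ a = 1 := by decide +revert
    all_goals simp
  have hcard : (Finset.univ.filter fun i => ¬ e i ≠ 0).card = n - hammingNorm e := by
    rw [hammingNorm, ← Finset.compl_filter, Finset.card_compl, Fintype.card_fin]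
  calc (bscNoise p n e).toReal
      = ∏ i, (bernoulliMeasure (1 : ZMod 2) 0 p).real {e i} := by
        rw [bscNoise, Measure.toPMF_apply, Measure.pi_singleton, ENNReal.toReal_prod]; rfl
    _ = ∏ i, if e i ≠ 0 then (p : ℝ) else 1 - p := Finset.prod_congr rfl fun i _ => hcoord (e i)
    _ = (p : ℝ) ^ hammingNorm e * (1 - p : ℝ) ^ (n - hammingNorm e) := by
        rw [Finset.prod_ite, Finset.prod_const, Finset.prod_const, hcard, hammingNorm]

theorem one_sub_le_bscNoise_toMeasure_real (hn : n ≠ 0) (p : I) (g : Fin n → ZMod 2 → ZMod 2)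
    {γ : ℝ} (hγ : 0 < γ) :
    1 - ((2 * γ) ^ 2)⁻¹ / n ≤ (bscNoise p n).toMeasure.real {e |
      |(hammingNorm (errorVector g e) : ℝ) - ((1 - p) * hammingNorm (errorVector g 0) +
        p * hammingNorm (errorVector g 1))| < γ * n} := by
  set X : Fin n → ZMod 2 → ℝ := fun i a => if g i a ≠ 0 then 1 else 0 with hX
  have hnorm (e : Word n) : (hammingNorm (errorVector g e) : ℝ) = ∑ i, X i (e i) := by
    rw [hammingNorm, Finset.natCast_card_filter]
    rfl
  have hmean : ∑ i, ∫ a, X i a ∂bernoulliMeasure (1 : ZMod 2) 0 p =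
      (1 - p) * hammingNorm (errorVector g 0) + p * hammingNorm (errorVector g 1) := by
    simp only [hnorm, integral_bernoulliMeasure, smul_eq_mul, Finset.sum_add_distrib,
      Finset.mul_sum, Pi.zero_apply, Pi.one_apply]
    exact add_comm _ _
  have hpi := one_sub_le_pi_real_abs_sum_sub_lt (μ := fun _ => bernoulliMeasure (1 : ZMod 2) 0 p)
    (X := X) (a := 0) (b := 1) (c := γ * n) (fun i => (measurable_of_countable _).aemeasurable)
    (fun i => ae_of_all _ fun a => by by_cases h : g i a = 0 <;> simp [hX, h]) (by positivity)
  have hvar : (∑ _ : Fin n, (((1 : ℝ) - 0) / 2) ^ 2) / (γ * n) ^ 2 = ((2 * γ) ^ 2)⁻¹ / n := by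
    rw [Finset.sum_const, Finset.card_univ, Fintype.card_fin, nsmul_eq_mul]
    field_simp
    norm_num
  simp only [hmean, ← hnorm] at hpi
  rw [bscNoise, Measure.toPMF_toMeasure, ← hvar]
  exact hpi

theorem hammingNorm_add_one (x : Word n) : (hammingNorm (x + 1) : ℝ) = n - hammingNorm x := by
  have hflip : (Finset.univ.filter fun i => ¬ x i ≠ 0) = Finset.univ.filter fun i => x i + 1 ≠ 0 :=
    Finset.filter_congr fun i _ => by generalize x i = a; decide +revert
  have hcard := Finset.card_filter_add_card_filter_not (s := Finset.univ) fun i => x i ≠ 0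
  rw [hflip, Finset.card_univ, Fintype.card_fin] at hcard
  exact eq_sub_of_add_eq' (mod_cast hcard)

theorem one_sub_le_bscNoise_toMeasure_real_hammingDist (hn : n ≠ 0) (p : I) (d x : Word n)
    {γ : ℝ} (hγ : 0 < γ) :
    1 - ((2 * γ) ^ 2)⁻¹ / n ≤ (bscNoise p n).toMeasure.real {e |
      |(hammingDist d (x + e) : ℝ) - (p * n + (1 - 2 * p) * hammingDist d x)| < γ * n} := by
  have hconc := one_sub_le_bscNoise_toMeasure_real hn p (fun i a => -d i + (x i + a)) hγ
  have hvec (e : Word n) : (hammingNorm (errorVector (fun i a => -d i + (x i + a)) e)) =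
      hammingDist d (x + e) := (hammingDist_eq_hammingNorm d (x + e)).symm
  have hmean : (1 - p : ℝ) * hammingDist d (x + 0) + p * hammingDist d (x + 1) =
      p * n + (1 - 2 * p) * hammingDist d x := by
    rw [hammingDist_eq_hammingNorm d (x + 1), ← add_assoc, hammingNorm_add_one,
      ← hammingDist_eq_hammingNorm, add_zero]
    ring
  simpa only [hvec, hmean] using hconc

theorem one_sub_le_bscNoise_toMeasure_real_hammingNorm (hn : n ≠ 0) (p : I) {γ : ℝ}
    (hγ : 0 < γ) :
    1 - ((2 * γ) ^ 2)⁻¹ / n ≤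
      (bscNoise p n).toMeasure.real {e | |(hammingNorm e : ℝ) - p * n| < γ * n} := by
  simpa using one_sub_le_bscNoise_toMeasure_real_hammingDist hn p 0 0 hγ

end BinarySymmetricNoise

section Entropy

open Real

theorem pow_mul_one_sub_pow_eq_exp {p : ℝ} (h0 : 0 < p) (h1 : p < 1) {k n : ℕ} (hk : k ≤ n) :
    p ^ k * (1 - p) ^ (n - k) =
      exp (-(n * binEntropy p) + (k - n * p) * (log p - log (1 - p))) := by
  rw [← exp_log (pow_pos h0 k), ← exp_log (pow_pos (sub_pos.2 h1) (n - k)), ← exp_add, log_pow,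
    log_pow, Nat.cast_sub hk, binEntropy, log_inv, log_inv]
  ring_nf

variable {n : ℕ}

theorem bscNoise_apply_toReal_le {p : I} (hp : (p : ℝ) ≤ 1 / 2) {γ : ℝ} {e : Word n}
    (he : (p - γ) * n ≤ hammingNorm e) :
    (bscNoise p n e).toReal ≤ exp (-(n * (binEntropy p - γ * (log (1 - p) - log p)))) := by
  rw [bscNoise_apply_toReal]
  rcases p.2.1.eq_or_lt with h0 | h0
  · simpa [← h0] using pow_le_one₀ le_rfl zero_le_one
  · have hlog : log p ≤ log (1 - p) := log_le_log h0 (by linarith)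
    rw [pow_mul_one_sub_pow_eq_exp h0 (by linarith)
      (hammingNorm_le_card_fintype.trans_eq (Fintype.card_fin n)), exp_le_exp]
    nlinarith

theorem card_le_hammingDist_le_exp (d : Word n) {r : ℝ} (hr : r < 1) :
    ((Finset.univ.filter fun y => r * n ≤ hammingDist d y).card : ℝ) ≤
      exp (n * binEntropy (max (1 / 2) r)) := by
  set q : ℝ := max (1 / 2) r
  have hq2 : 1 / 2 ≤ q := le_max_left _ _
  have hq1 : q < 1 := max_lt (by norm_num) hr
  let q' : I := ⟨q, by linarith, hq1.le⟩
  have hmass (y : Word n) (hy : r * n ≤ hammingDist d y) :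
      exp (-(n * binEntropy q)) ≤ (bscNoise q' n (-d + y)).toReal := by
    rw [bscNoise_apply_toReal, pow_mul_one_sub_pow_eq_exp (by positivity) hq1
      (hammingNorm_le_card_fintype.trans_eq (Fintype.card_fin n)), exp_le_exp,
      ← hammingDist_eq_hammingNorm, le_add_iff_nonneg_right]
    rcases le_total r (1 / 2) with hr2 | hr2
    · rw [show q = 1 / 2 from max_eq_left hr2]
      norm_num
    · rw [show q = r from max_eq_right hr2]
      exact mul_nonneg (by linarith) (sub_nonneg.2 (log_le_log (by linarith) (by linarith)))
  have hsum := calc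
    (Finset.univ.filter fun y => r * n ≤ hammingDist d y).card * exp (-(n * binEntropy q))
        = ∑ y with r * n ≤ hammingDist d y, exp (-(n * binEntropy q)) := by
          rw [Finset.sum_const, nsmul_eq_mul]
      _ ≤ ∑ y with r * n ≤ hammingDist d y, (bscNoise q' n (-d + y)).toReal :=
          Finset.sum_le_sum fun y hy => hmass y (Finset.mem_filter.1 hy).2
      _ ≤ ∑ y, (bscNoise q' n (-d + y)).toReal :=
          Finset.sum_le_univ_sum_of_nonneg fun _ => ENNReal.toReal_nonneg
      _ = ∑ e, (bscNoise q' n e).toReal :=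
          Equiv.sum_comp (Equiv.addLeft (-d)) fun e => (bscNoise q' n e).toReal
      _ = 1 := sum_toReal_eq_one _
  rwa [exp_neg, ← div_eq_mul_inv, div_le_one (exp_pos _)] at hsum

end Entropy

section AdditiveNoise

open Real

/-- The adversary that adds a noise word of law `Q`, whatever the transmitted codeword. -/
noncomputable def additiveStrategy {n : ℕ} (Q : PMF (Word n)) : Strategy n :=
  Q.map fun e i _ => e i

theorem sum_toMeasure_real_le_avgError_additiveStrategy {n : ℕ} (C : Code n) (Q : PMF (Word n))
    {β : ℝ} (hβ : 0 ≤ β) (A : Finset C.words) (T : Finset (Word n)) :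
    ∑ x ∈ A, Q.toMeasure.real {e | (Q e).toReal ≤ β ∧ x.1 + e ∈ T} ≤
      C.words.card * avgError C (additiveStrategy Q) + β * T.card := by
  set D : Word n → C.words → ℝ := fun y x => (C.decoder y x).toReal
  have hpoint (x : C.words) (e : Word n) :
      (Q e).toReal * Set.indicator {e | (Q e).toReal ≤ β ∧ x.1 + e ∈ T} 1 e ≤
        (Q e).toReal * C.missProb (x.1 + e) x + if x.1 + e ∈ T then β * D (x.1 + e) x else 0 := by
    have hmiss := mul_nonneg (ENNReal.toReal_nonneg (a := Q e)) (C.missProb_nonneg (x.1 + e) x)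
    have hD : 0 ≤ D (x.1 + e) x := ENNReal.toReal_nonneg
    by_cases hT : x.1 + e ∈ T
    · by_cases hQ : (Q e).toReal ≤ β
      · have := mul_le_mul_of_nonneg_right hQ hD
        simp only [Set.indicator_apply, Set.mem_ofPred_eq, hT, hQ, and_self, if_true,
          Pi.one_apply, Code.missProb]
        linarith
      · simp only [Set.indicator_apply, Set.mem_ofPred_eq, hT, hQ, false_and, if_false, if_true]
        nlinarith
    · simpa [hT] using hmiss
  have hreceived (x : C.words) :
      ∑ e, (if x.1 + e ∈ T then β * D (x.1 + e) x else 0) = ∑ y ∈ T, β * D y x := by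
    refine (Equiv.sum_comp (Equiv.addLeft x.1) fun y => if y ∈ T then β * D y x else 0).trans ?_
    rw [Finset.sum_ite_mem, Finset.univ_inter]
  have hdecode : ∑ x : C.words, ∑ y ∈ T, β * D y x = β * T.card := by
    rw [Finset.sum_comm]
    simp only [← Finset.mul_sum, D, sum_toReal_eq_one, Finset.sum_const, nsmul_one]
  calc ∑ x ∈ A, Q.toMeasure.real {e | (Q e).toReal ≤ β ∧ x.1 + e ∈ T}
      ≤ ∑ x : C.words, Q.toMeasure.real {e | (Q e).toReal ≤ β ∧ x.1 + e ∈ T} :=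
        Finset.sum_le_univ_sum_of_nonneg fun _ => measureReal_nonneg
    _ ≤ ∑ x : C.words, ((∑ e, (Q e).toReal * C.missProb (x.1 + e) x) + ∑ y ∈ T, β * D y x) := by
        simp only [toMeasure_real_eq_sum, ← hreceived, ← Finset.sum_add_distrib]
        exact Finset.sum_le_sum fun x _ => Finset.sum_le_sum fun e _ => hpoint x e
    _ = C.words.card * avgError C (additiveStrategy Q) + β * T.card := by
        rw [Finset.sum_add_distrib, hdecode, additiveStrategy, avgError_map, one_div,
          mul_inv_cancel_left₀ C.card_pos.ne']
        rfl

theorem tendsto_one_sub_const_div_natCast (c : ℝ) :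
    Tendsto (fun n : ℕ => 1 - c / n) atTop (𝓝 1) := by
  simpa only [sub_zero] using (tendsto_const_div_atTop_nhds_zero_nat c).const_sub 1

theorem stronglyLimited_additiveStrategy_bscNoise (C : ∀ n, Code n) (p : I) :
    StronglyLimited C p fun n => additiveStrategy (bscNoise p n) := by
  refine .of_le fun ε hε => ⟨_, tendsto_one_sub_const_div_natCast ((2 * ε) ^ 2)⁻¹, ?_⟩
  filter_upwards [eventually_ne_atTop 0] with n hn
  rw [additiveStrategy, probWeightLT_map, one_div_mul_eq_div, le_div_iff₀' (C n).card_pos,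
    ← nsmul_eq_mul]
  refine Finset.card_nsmul_le_sum _ _ _ fun x _ =>
    (one_sub_le_bscNoise_toMeasure_real_hammingNorm hn p hε).trans (measureReal_mono fun e he => ?_)
  change (hammingNorm e : ℝ) / n < p + ε
  rw [div_lt_iff₀ (by positivity)]
  linarith [(abs_lt.1 (show |(hammingNorm e : ℝ) - p * n| < ε * n from he)).2]

theorem add_sub_one_le_measureReal_inter {Ω : Type*} [MeasurableSpace Ω] {μ : Measure Ω}
    [IsProbabilityMeasure μ] (s : Set Ω) {t : Set Ω} (ht : MeasurableSet t) :
    μ.real s + μ.real t - 1 ≤ μ.real (s ∩ t) := by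
  linarith [measureReal_union_add_inter (μ := μ) (s := s) ht,
    measureReal_le_one (μ := μ) (s := s ∪ t)]

theorem card_mul_le_avgError_bscNoise {n : ℕ} (hn : n ≠ 0) (C : Code n) {p : I}
    (hp : (p : ℝ) ≤ 1 / 2) {γ : ℝ} (hγ : 0 < γ) {A : Finset C.words} {T : Finset (Word n)} {τ : ℝ}
    (hA : ∀ x ∈ A, τ ≤ (bscNoise p n).toMeasure.real {e | x.1 + e ∈ T}) :
    A.card * (τ - ((2 * γ) ^ 2)⁻¹ / n) ≤
      C.words.card * avgError C (additiveStrategy (bscNoise p n)) +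
        exp (-(n * (binEntropy p - γ * (log (1 - p) - log p)))) * T.card := by
  refine le_trans ?_ (sum_toMeasure_real_le_avgError_additiveStrategy C _ (exp_pos _).le A T)
  rw [← nsmul_eq_mul]
  refine Finset.card_nsmul_le_sum _ _ _ fun x hx => ?_
  calc τ - ((2 * γ) ^ 2)⁻¹ / n
      ≤ (bscNoise p n).toMeasure.real {e | |(hammingNorm e : ℝ) - p * n| < γ * n} +
          (bscNoise p n).toMeasure.real {e | x.1 + e ∈ T} - 1 := by
        linarith [hA x hx, one_sub_le_bscNoise_toMeasure_real_hammingNorm hn p hγ]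
    _ ≤ _ := add_sub_one_le_measureReal_inter _ .of_discrete
    _ ≤ _ := measureReal_mono (Set.inter_subset_inter_left _ fun e he =>
        bscNoise_apply_toReal_le hp
          (by linarith [(abs_lt.1 (show |(hammingNorm e : ℝ) - p * n| < γ * n from he)).1]))

theorem exists_pos_le_of_continuous {f : ℝ → ℝ} (hf : Continuous f) {c : ℝ} (h0 : f 0 < c) :
    ∃ γ > 0, f γ ≤ c :=
  ((eventually_mem_nhdsWithin (a := (0 : ℝ)) (s := Set.Ioi 0)).and
    ((hf.tendsto 0).mono_left nhdsWithin_le_nhds |>.eventually_le_const h0)).exists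

theorem eventually_le_exp_natCast_mul (c : ℝ) {η : ℝ} (hη : 0 < η) :
    ∀ᶠ n : ℕ in atTop, c ≤ exp (n * η) :=
  (tendsto_exp_atTop.comp
    (tendsto_natCast_atTop_atTop.atTop_mul_const hη)).eventually_ge_atTop c

theorem IsGood.eventually_card_le_mul_exp {C : ∀ n, Code n} {p : I} {ε α τ η : ℝ}
    (hC : IsGood p ε C) (hp : (p : ℝ) ≤ 1 / 2) (hτ : 0 < τ) (hε : ε < α * τ) (hη : 0 < η) :
    ∀ᶠ n : ℕ in atTop, ∀ (A : Finset (C n).words) (T : Finset (Word n)),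
      α * (C n).words.card ≤ A.card →
      (∀ x ∈ A, τ ≤ (bscNoise p n).toMeasure.real {e | x.1 + e ∈ T}) →
      ((C n).words.card : ℝ) ≤ T.card * exp (n * (η - binEntropy p)) := by
  set L := log (1 - p) - log p
  set κ := (α * τ - ε) / 2
  have hκ : 0 < κ := by simp only [κ]; linarith
  obtain ⟨γ, hγ, hγL⟩ : ∃ γ > 0, γ * L ≤ η / 2 :=
    exists_pos_le_of_continuous (continuous_mul_const L) (by rw [zero_mul]; exact half_pos hη)
  have hθ : Tendsto (fun n : ℕ => ((2 * γ) ^ 2)⁻¹ / (n : ℝ)) atTop (𝓝 0) :=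
    tendsto_const_div_atTop_nhds_zero_nat _
  have hτθ : ∀ᶠ n : ℕ in atTop, 0 < τ - ((2 * γ) ^ 2)⁻¹ / n :=
    (hθ.const_sub τ).eventually_const_lt (by simpa)
  have hκθ : ∀ᶠ n : ℕ in atTop, ε + κ < α * (τ - ((2 * γ) ^ 2)⁻¹ / n) :=
    ((hθ.const_sub τ).const_mul α).eventually_const_lt (by simp only [κ, sub_zero]; linarith)
  filter_upwards [eventually_ne_atTop 0, hτθ, hκθ, eventually_le_exp_natCast_mul κ⁻¹ (half_pos hη),
    hC _ (stronglyLimited_additiveStrategy_bscNoise C p)] with n hn hτθ hκθ hexp hgood A T hA hAT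
  have hcard := (C n).card_pos
  have hmain : κ * (C n).words.card ≤ exp (-(n * (binEntropy p - γ * L))) * T.card := by
    have := card_mul_le_avgError_bscNoise hn (C n) hp hγ hAT
    have := mul_le_mul_of_nonneg_right hA hτθ.le
    nlinarith
  calc ((C n).words.card : ℝ) = κ⁻¹ * (κ * (C n).words.card) :=
        (inv_mul_cancel_left₀ hκ.ne' _).symm
    _ ≤ exp (n * (η / 2)) * (exp (-(n * (binEntropy p - γ * L))) * T.card) := by gcongr
    _ = T.card * exp (n * (γ * L + η / 2 - binEntropy p)) := by
        rw [← mul_assoc, ← exp_add, mul_comm]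
        ring_nf
    _ ≤ T.card * exp (n * (η - binEntropy p)) := by gcongr; linarith

end AdditiveNoise

section Symmetrizing

variable {n : ℕ}

/-- The word that agrees with `x` where the mask `b` is `0`, and with `x'` where it is `1`. -/
def maskedMix (b x x' : Word n) : Word n := fun i => if b i = 0 then x i else x' i

theorem maskedMix_add_one (b x x' : Word n) : maskedMix (b + 1) x x' = maskedMix b x' x := by
  have hflip : ∀ a : ZMod 2, a + 1 = 0 ↔ ¬ a = 0 := by decide
  ext i
  simp only [maskedMix, Pi.add_apply, Pi.one_apply, hflip, ite_not]

/-- A uniformly random mask, presented as the noise of the binary symmetric channel with crossover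
probability `1/2` so that its concentration is a case of that of `bscNoise`. -/
noncomputable def fairMask (n : ℕ) : PMF (Word n) := bscNoise ⟨1 / 2, by norm_num⟩ n

theorem fairMask_apply_toReal (b : Word n) : (fairMask n b).toReal = (1 / 2) ^ n := by
  have hle : hammingNorm b ≤ n := hammingNorm_le_card_fintype.trans_eq (Fintype.card_fin n)
  rw [fairMask, bscNoise_apply_toReal, sub_half, ← pow_add, Nat.add_sub_cancel' hle]

/-- The adversary that replaces each transmitted bit, independently with probability `1/2`, by the
corresponding bit of `x'`. -/
noncomputable def overwriteStrategy (x' : Word n) : Strategy n :=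
  (fairMask n).map fun b i a => if b i = 0 then 0 else a + x' i

/-- The probability that the decoder misses `x` when `overwriteStrategy x'` acts on it. -/
noncomputable def Code.confusion (C : Code n) (x x' : C.words) : ℝ :=
  ∑ b, (fairMask n b).toReal * C.missProb (maskedMix b x.1 x'.1) x

theorem Code.confusion_nonneg (C : Code n) (x x' : C.words) : 0 ≤ C.confusion x x' :=
  Finset.sum_nonneg fun _ _ => mul_nonneg ENNReal.toReal_nonneg (C.missProb_nonneg _ _)

theorem avgError_overwriteStrategy (C : Code n) (x' : C.words) :
    avgError C (overwriteStrategy x'.1) =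
      1 / (C.words.card : ℝ) * ∑ x : C.words, C.confusion x x' := by
  have hmix (b x : Word n) :
      x + errorVector (fun i a => if b i = 0 then 0 else a + x'.1 i) x = maskedMix b x x'.1 := by
    ext i
    by_cases hb : b i = 0
    · simp [errorVector, maskedMix, hb]
    · simp [errorVector, maskedMix, hb, ← add_assoc, CharTwo.add_self_eq_zero]
  simp only [overwriteStrategy, avgError_map, Code.confusion, hmix]

theorem Code.one_le_missProb_add_missProb (C : Code n) (y : Word n) {x x' : C.words}
    (h : x ≠ x') : 1 ≤ C.missProb y x + C.missProb y x' := by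
  have hpair : ∑ z ∈ {x, x'}, (C.decoder y z).toReal ≤ 1 :=
    (Finset.sum_le_univ_sum_of_nonneg fun _ => ENNReal.toReal_nonneg).trans_eq
      (sum_toReal_eq_one (C.decoder y))
  rw [Finset.sum_pair h] at hpair
  simp only [Code.missProb]
  linarith

-- Exchanging the kept and the overwritten coordinates exchanges the roles of `x` and `x'`.
theorem Code.one_le_confusion_add_confusion (C : Code n) {x x' : C.words} (h : x ≠ x') :
    1 ≤ C.confusion x x' + C.confusion x' x := by
  have hswap : C.confusion x' x =
      ∑ b, (fairMask n b).toReal * C.missProb (maskedMix b x.1 x'.1) x' := by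
    rw [Code.confusion, ← Equiv.sum_comp (Equiv.addRight (1 : Word n))]
    simp only [Equiv.coe_addRight, maskedMix_add_one, fairMask_apply_toReal]
  calc 1 = ∑ b, (fairMask n b).toReal := (sum_toReal_eq_one _).symm
    _ ≤ ∑ b, (fairMask n b).toReal *
          (C.missProb (maskedMix b x.1 x'.1) x + C.missProb (maskedMix b x.1 x'.1) x') :=
        Finset.sum_le_sum fun b _ => le_mul_of_one_le_right ENNReal.toReal_nonneg
          (C.one_le_missProb_add_missProb _ h)
    _ = C.confusion x x' + C.confusion x' x := by
        rw [hswap, Code.confusion, ← Finset.sum_add_distrib]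
        simp only [mul_add]

theorem card_mul_card_sub_one_le_two_mul_sum {α : Type*} (G : Finset α) {f : α → α → ℝ}
    (h0 : ∀ x, 0 ≤ f x x) (h1 : ∀ x y, x ≠ y → 1 ≤ f x y + f y x) :
    (G.card : ℝ) * (G.card - 1) ≤ 2 * ∑ x ∈ G, ∑ y ∈ G, f x y := by
  classical
  have hoff (x y : α) : 1 - (if x = y then 1 else 0) ≤ f x y + f y x := by
    split_ifs with hxy
    · subst hxy
      linarith [h0 x]
    · linarith [h1 x y hxy]
  calc (G.card : ℝ) * (G.card - 1) = ∑ x ∈ G, ∑ y ∈ G, (1 - (if x = y then (1 : ℝ) else 0)) := by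
        simp only [Finset.sum_sub_distrib, Finset.sum_const, nsmul_eq_mul, mul_one,
          Finset.sum_ite_eq, Finset.sum_ite_mem, Finset.inter_self]
        ring
    _ ≤ ∑ x ∈ G, ∑ y ∈ G, (f x y + f y x) :=
        Finset.sum_le_sum fun x _ => Finset.sum_le_sum fun y _ => hoff x y
    _ = 2 * ∑ x ∈ G, ∑ y ∈ G, f x y := by
        simp only [Finset.sum_add_distrib]
        rw [Finset.sum_comm (f := fun x y => f y x), two_mul]

/-- The adversary that overwrites random bits by those of a random element of `G`. -/
noncomputable def symmetrizingStrategy (C : Code n) (G : Finset C.words) (hG : G.Nonempty) :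
    Strategy n :=
  (PMF.uniformOfFinset G hG).bind fun x' => overwriteStrategy x'.1

theorem sum_uniformOfFinset_toReal_mul {α : Type*} [Fintype α] (G : Finset α) (hG : G.Nonempty)
    (g : α → ℝ) :
    ∑ a, (PMF.uniformOfFinset G hG a).toReal * g a = 1 / (G.card : ℝ) * ∑ a ∈ G, g a := by
  classical
  simp only [PMF.uniformOfFinset_apply, apply_ite ENNReal.toReal, ite_mul, Finset.mul_sum]
  simp

theorem le_avgError_symmetrizingStrategy (C : Code n) (G : Finset C.words) (hG : G.Nonempty) :
    ((G.card : ℝ) - 1) / (2 * C.words.card) ≤ avgError C (symmetrizingStrategy C G hG) := by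
  have hG0 : (0 : ℝ) < G.card := Nat.cast_pos.2 hG.card_pos
  have hC0 := C.card_pos
  rw [symmetrizingStrategy, avgError_bind, sum_uniformOfFinset_toReal_mul]
  simp only [avgError_overwriteStrategy]
  have hpairs := card_mul_card_sub_one_le_two_mul_sum G (fun x => C.confusion_nonneg x x)
    (fun x x' => C.one_le_confusion_add_confusion)
  have hsub : ∑ x ∈ G, ∑ x' ∈ G, C.confusion x' x ≤ ∑ x ∈ G, ∑ x', C.confusion x' x :=
    Finset.sum_le_sum fun x _ => Finset.sum_le_univ_sum_of_nonneg fun x' => C.confusion_nonneg x' x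
  rw [Finset.sum_comm] at hpairs
  rw [← Finset.mul_sum, div_le_iff₀ (by positivity)]
  field_simp
  linarith

theorem one_sub_le_fairMask_toMeasure_real (hn : n ≠ 0) (d x : Word n) {ε : ℝ} (hε : 0 < ε) :
    1 - ((2 * ε) ^ 2)⁻¹ / n ≤ (fairMask n).toMeasure.real {b |
      (hammingNorm (errorVector (fun i a => if b i = 0 then 0 else a + d i) x) : ℝ) <
        hammingDist d x / 2 + ε * n} := by
  have hdiff : hammingNorm (fun i => x i + d i) = hammingDist d x := by
    simp only [hammingNorm, hammingDist, ne_eq, CharTwo.add_eq_zero, eq_comm]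
  refine (one_sub_le_bscNoise_toMeasure_real hn _
    (fun i a => if a = 0 then 0 else x i + d i) hε).trans (measureReal_mono fun b hb => ?_)
  have h0 : errorVector (fun i a => if a = 0 then 0 else x i + d i) 0 = 0 := by
    ext i
    simp [errorVector]
  have h1 : errorVector (fun i a => if a = 0 then 0 else x i + d i) 1 = fun i => x i + d i := by
    ext i
    simp [errorVector]
  rw [Set.mem_ofPred_eq, h0, h1, hdiff] at hb
  have hlt := (abs_lt.1 hb).2
  simp only [hammingNorm_zero, Nat.cast_zero] at hlt
  change (hammingNorm (errorVector (fun i a => if a = 0 then 0 else x i + d i) b) : ℝ) < _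
  linarith

/-- The codewords at relative distance more than `r` from `d`. -/
noncomputable def Code.farWords (C : Code n) (r : ℝ) (d : Word n) : Finset C.words :=
  Finset.univ.filter fun x => r * n < hammingDist d x.1

/-- The codewords that are at relative distance more than `r` from at most a fraction `δ` of the
code. Overwriting half of the transmitted bits by those of such a word causes few errors. -/
noncomputable def Code.centralWords (C : Code n) (r δ : ℝ) : Finset C.words :=
  Finset.univ.filter fun d => ((C.farWords r d.1).card : ℝ) ≤ δ * C.words.card

theorem le_probWeightLT_overwriteStrategy (hn : n ≠ 0) (C : Code n) {r δ ε : ℝ} (hε : 0 < ε)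
    {d : C.words} (hd : d ∈ C.centralWords r δ) :
    1 - ((2 * ε) ^ 2)⁻¹ / n - δ ≤ probWeightLT C (overwriteStrategy d.1) (r / 2 + ε) := by
  set θ : ℝ := ((2 * ε) ^ 2)⁻¹ / n
  set s : C.words → Set (Word n) := fun x => {b | (hammingNorm (errorVector
    (fun i a => if b i = 0 then 0 else a + d.1 i) x.1) : ℝ) / n < r / 2 + ε}
  have hword (x : C.words) :
      1 - θ - (if x ∈ C.farWords r d.1 then 1 else 0) ≤ (fairMask n).toMeasure.real (s x) := by
    by_cases hx : x ∈ C.farWords r d.1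
    · have hθ : 0 ≤ θ := by positivity
      simp only [hx, if_true]
      linarith [measureReal_nonneg (μ := (fairMask n).toMeasure) (s := s x)]
    · have hclose : (hammingDist d.1 x.1 : ℝ) ≤ r * n := by
        simpa only [Code.farWords, Finset.mem_filter_univ, not_lt] using hx
      rw [if_neg hx, sub_zero]
      refine (one_sub_le_fairMask_toMeasure_real hn d.1 x.1 hε).trans
        (measureReal_mono fun b hb => ?_)
      rw [Set.mem_ofPred_eq] at hb
      rw [Set.mem_ofPred_eq, div_lt_iff₀ (by positivity)]
      linarith
  have hfar : ((C.farWords r d.1).card : ℝ) ≤ δ * C.words.card := (Finset.mem_filter.1 hd).2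
  rw [overwriteStrategy, probWeightLT_map, one_div_mul_eq_div, le_div_iff₀ C.card_pos,
    ← Finset.sum_coe_sort]
  calc (1 - θ - δ) * C.words.card ≤ (1 - θ) * C.words.card - (C.farWords r d.1).card := by
        linarith
    _ = ∑ x : C.words, (1 - θ - if x ∈ C.farWords r d.1 then 1 else 0) := by
        rw [Finset.sum_sub_distrib, Finset.sum_const, Finset.sum_boole, Finset.filter_univ_mem,
          Finset.card_univ, Fintype.card_coe, nsmul_eq_mul, mul_comm]
    _ ≤ _ := Finset.sum_le_sum fun x _ => hword x

theorem le_probWeightLT_symmetrizingStrategy (hn : n ≠ 0) (C : Code n) {r δ ε : ℝ} (hε : 0 < ε)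
    (hG : (C.centralWords r δ).Nonempty) :
    1 - ((2 * ε) ^ 2)⁻¹ / n - δ ≤
      probWeightLT C (symmetrizingStrategy C (C.centralWords r δ) hG) (r / 2 + ε) := by
  have hG0 : (0 : ℝ) < (C.centralWords r δ).card := Nat.cast_pos.2 hG.card_pos
  rw [symmetrizingStrategy, probWeightLT_bind, sum_uniformOfFinset_toReal_mul,
    one_div_mul_eq_div, le_div_iff₀' hG0, ← nsmul_eq_mul]
  exact Finset.card_nsmul_le_sum _ _ _ fun d hd => le_probWeightLT_overwriteStrategy hn C hε hd

end Symmetrizing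

section Subsequences

theorem probWeightLT_pure_zero {n : ℕ} (C : Code n) {t : ℝ} (ht : 0 < t) :
    probWeightLT C (PMF.pure 0) t = 1 := by
  have hzero (x : Word n) : errorVector (0 : Fin n → ZMod 2 → ZMod 2) x = 0 := rfl
  rw [probWeightLT_eq_sum_toMeasure_real, one_div_mul_eq_div, div_eq_one_iff_eq C.card_pos.ne']
  simp [PMF.toMeasure_pure, Measure.real, hzero, ht]

variable {C : ∀ n, Code n} {p ε : ℝ}

theorem IsGood.eventually_avgError_comp_le (hC : IsGood p ε C) (hp : 0 ≤ p) {φ : ℕ → ℕ}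
    (hφ : StrictMono φ) (ν : ∀ k, Strategy (φ k))
    (hν : ∀ ε' : ℝ, 0 < ε' → Tendsto (fun k => probWeightLT (C (φ k)) (ν k) (p + ε')) atTop (𝓝 1)) :
    ∀ᶠ k in atTop, avgError (C (φ k)) (ν k) ≤ ε := by
  have hextend (n : ℕ) : ∃ μ : Strategy n,
      (∀ k, ∀ h : φ k = n, h ▸ ν k = μ) ∧ (n ∉ Set.range φ → μ = PMF.pure 0) := by
    by_cases hn : n ∈ Set.range φ
    · obtain ⟨k, rfl⟩ := hn
      refine ⟨ν k, fun j hj => ?_, fun h => absurd ⟨k, rfl⟩ h⟩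
      obtain rfl := hφ.injective hj
      rfl
    · exact ⟨PMF.pure 0, fun k h => absurd ⟨k, h⟩ hn, fun _ => rfl⟩
  choose μ hμ hμ0 using hextend
  have hlim : StronglyLimited C p μ := by
    intro ε' hε'
    refine tendsto_order.2 ⟨fun t ht => ?_, fun t ht => Eventually.of_forall fun n =>
      (probWeightLT_le_one _ _ _).trans_lt ht⟩
    obtain ⟨k₀, hk₀⟩ := eventually_atTop.1 ((hν ε' hε').eventually_const_lt ht)
    filter_upwards [eventually_ge_atTop (φ k₀)] with n hn
    by_cases hrange : n ∈ Set.range φ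
    · obtain ⟨k, rfl⟩ := hrange
      rw [← hμ (φ k) k rfl]
      exact hk₀ k (hφ.le_iff_le.1 hn)
    · rwa [hμ0 n hrange, probWeightLT_pure_zero _ (by positivity)]
  filter_upwards [hφ.tendsto_atTop.eventually (hC μ hlim)] with k hk
  rwa [← hμ (φ k) k rfl] at hk

theorem IsGood.exists_eventually_card_centralWords_lt (hC : IsGood p ε C) (hp : 0 ≤ p)
    (hε : ε < 1 / 8) :
    ∃ δ : ℝ, 0 < δ ∧ δ ≤ 1 ∧ ∀ᶠ n in atTop, 4 ≤ (C n).words.card →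
      2 * ((C n).centralWords (2 * p) δ).card < (C n).words.card := by
  have hδ : Tendsto (fun k : ℕ => 1 / ((k : ℝ) + 1)) atTop (𝓝 0) :=
    tendsto_one_div_add_atTop_nhds_zero_nat
  by_contra! hmany
  obtain ⟨φ, hφ, hφC⟩ := extraction_forall_of_frequently fun k : ℕ =>
    hmany (1 / ((k : ℝ) + 1)) Nat.one_div_pos_of_nat
      (div_le_one_of_le₀ (by linarith [Nat.cast_nonneg (α := ℝ) k]) (by positivity))
  have hne (k : ℕ) : ((C (φ k)).centralWords (2 * p) (1 / ((k : ℝ) + 1))).Nonempty :=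
    Finset.card_pos.1 (by have := hφC k; lia)
  have hweight (ε' : ℝ) (hε' : 0 < ε') : Tendsto (fun k => probWeightLT (C (φ k))
      (symmetrizingStrategy (C (φ k)) _ (hne k)) (p + ε')) atTop (𝓝 1) := by
    have hlower := ((tendsto_one_sub_const_div_natCast ((2 * ε') ^ 2)⁻¹).comp
      hφ.tendsto_atTop).sub hδ
    rw [sub_zero] at hlower
    refine tendsto_of_tendsto_of_tendsto_of_le_of_le' hlower tendsto_const_nhds ?_
      (Eventually.of_forall fun k => probWeightLT_le_one _ _ _)
    filter_upwards [hφ.tendsto_atTop.eventually_ne_atTop 0] with k hk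
    have := le_probWeightLT_symmetrizingStrategy hk (C (φ k)) hε' (hne k)
    rwa [mul_div_cancel_left₀ p two_ne_zero] at this
  obtain ⟨k, hk⟩ := (hC.eventually_avgError_comp_le hp hφ _ hweight).exists
  have hlarge : 4 ≤ ((C (φ k)).words.card : ℝ) := mod_cast (hφC k).1
  have hhalf : ((C (φ k)).words.card : ℝ) ≤
      2 * ((C (φ k)).centralWords (2 * p) (1 / ((k : ℝ) + 1))).card := mod_cast (hφC k).2
  have herror := (le_avgError_symmetrizingStrategy (C (φ k)) _ (hne k)).trans hk
  rw [div_le_iff₀ (by linarith)] at herror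
  nlinarith

end Subsequences

section Covering

theorem exists_card_le_card_sdiff_biUnion_le {α β : Type*} [DecidableEq β] (V : Finset α)
    (hV : V.Nonempty) (U : Finset β) (N : α → Finset β) {δ : ℝ} (hδ : δ ≤ 1)
    (h : ∀ x ∈ U, δ * V.card ≤ (V.filter fun d => x ∈ N d).card) (K : ℕ) :
    ∃ D : Finset α, D.card ≤ K ∧ ((U \ D.biUnion N).card : ℝ) ≤ (1 - δ) ^ K * U.card := by
  classical
  induction K with
  | zero => exact ⟨∅, by simp⟩
  | succ K ih =>
    obtain ⟨D, hDK, hD⟩ := ih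
    set W := U \ D.biUnion N
    obtain ⟨d, -, hd⟩ : ∃ d ∈ V, δ * W.card ≤ ((W ∩ N d).card : ℝ) := by
      refine Finset.exists_le_of_sum_le hV ?_
      calc ∑ _ ∈ V, δ * (W.card : ℝ) = ∑ _ ∈ W, δ * (V.card : ℝ) := by
            simp only [Finset.sum_const, nsmul_eq_mul]
            ring
        _ ≤ ∑ x ∈ W, ((V.filter fun d => x ∈ N d).card : ℝ) :=
            Finset.sum_le_sum fun x hx => h x (Finset.mem_sdiff.1 hx).1
        _ = ∑ d ∈ V, ((W ∩ N d).card : ℝ) := by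
            simp only [← Finset.filter_mem_eq_inter]
            exact mod_cast (Finset.sum_card_bipartiteAbove_eq_sum_card_bipartiteBelow _).symm
    refine ⟨insert d D, (Finset.card_insert_le _ _).trans (by lia), ?_⟩
    have hremain : U \ (insert d D).biUnion N = W \ N d := by
      rw [Finset.biUnion_insert, Finset.union_comm]
      exact sdiff_sdiff_left.symm
    have hsplit : ((W ∩ N d).card : ℝ) + (W \ N d).card = W.card :=
      mod_cast Finset.card_inter_add_card_sdiff W (N d)
    calc ((U \ (insert d D).biUnion N).card : ℝ) ≤ (1 - δ) * W.card := by rw [hremain]; linarith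
      _ ≤ (1 - δ) * ((1 - δ) ^ K * U.card) := mul_le_mul_of_nonneg_left hD (sub_nonneg.2 hδ)
      _ = (1 - δ) ^ (K + 1) * U.card := by ring

theorem Code.exists_card_le_four_mul_card_biUnion_farWords {n : ℕ} (C : Code n) {r δ : ℝ}
    (hδ : δ ≤ 1) {K : ℕ} (hK : (1 - δ) ^ K ≤ 1 / 2)
    (hcentral : 2 * (C.centralWords r δ).card < C.words.card) :
    ∃ D : Finset C.words, D.card ≤ K ∧
      C.words.card ≤ 4 * (D.biUnion fun d => C.farWords r d.1).card := by
  set U := (C.centralWords r δ)ᶜ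
  have hU : U.card + (C.centralWords r δ).card = C.words.card := by
    rw [Finset.card_compl_add_card, Fintype.card_coe]
  have hnoncentral (x : C.words) (hx : x ∈ U) : δ * C.words.card < (C.farWords r x.1).card := by
    simpa only [U, Code.centralWords, Finset.mem_compl, Finset.mem_filter_univ, not_le] using hx
  have : Nonempty C.words := C.nonempty.to_subtype
  obtain ⟨D, hDK, hD⟩ := exists_card_le_card_sdiff_biUnion_le Finset.univ Finset.univ_nonempty U
    (fun d : C.words => C.farWords r d.1) hδ (fun x hx => by
      simpa only [Code.farWords, Finset.mem_filter_univ, hammingDist_comm, Finset.card_univ,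
        Fintype.card_coe] using (hnoncentral x hx).le) K
  refine ⟨D, hDK, ?_⟩
  have hhalf : 2 * (U \ D.biUnion fun d => C.farWords r d.1).card ≤ U.card := by
    have := hD.trans (mul_le_mul_of_nonneg_right hK U.card.cast_nonneg)
    rify
    linarith
  have hsplit := Finset.le_card_sdiff (D.biUnion fun d => C.farWords r d.1) U
  lia

end Covering

section CapacityBound

open Real

theorem one_sub_le_bscNoise_toMeasure_real_of_mem_farWords {n : ℕ} (hn : n ≠ 0) {C : Code n}
    {p : I} (hp : (p : ℝ) ≤ 1 / 2) {d : Word n} {x : C.words} (hx : x ∈ C.farWords (2 * p) d)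
    {γ : ℝ} (hγ : 0 < γ) :
    1 - ((2 * γ) ^ 2)⁻¹ / n ≤ (bscNoise p n).toMeasure.real
      {e | (3 * p - 4 * p ^ 2 - γ : ℝ) * n ≤ hammingDist d (x.1 + e)} := by
  refine (one_sub_le_bscNoise_toMeasure_real_hammingDist hn p d x.1 hγ).trans
    (measureReal_mono fun e he => ?_)
  have hfar : 2 * (p : ℝ) * n < hammingDist d x.1 := (Finset.mem_filter.1 hx).2
  rw [Set.mem_ofPred_eq] at he ⊢
  nlinarith [(abs_lt.1 he).1]

theorem card_biUnion_le_hammingDist_le {n : ℕ} {ι : Type*} (D : Finset ι) (w : ι → Word n) {r : ℝ}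
    (hr : r < 1) :
    ((D.biUnion fun d => Finset.univ.filter fun y => r * n ≤ hammingDist (w d) y).card : ℝ) ≤
      D.card * exp (n * binEntropy (max (1 / 2) r)) :=
  calc _ ≤ ∑ d ∈ D, ((Finset.univ.filter fun y => r * n ≤ hammingDist (w d) y).card : ℝ) :=
        mod_cast Finset.card_biUnion_le
    _ ≤ ∑ _ ∈ D, exp (n * binEntropy (max (1 / 2) r)) :=
        Finset.sum_le_sum fun d _ => card_le_hammingDist_le_exp (w d) hr
    _ = _ := by rw [Finset.sum_const, nsmul_eq_mul]

theorem binEntropy_le_binEntropy_max {p : ℝ} (h0 : 0 ≤ p) (hp : p ≤ 1 / 2) :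
    binEntropy p ≤ binEntropy (max (1 / 2) (3 * p - 4 * p ^ 2)) := by
  have hmax : max (1 / 2) (3 * p - 4 * p ^ 2) ≤ 1 - p :=
    max_le (by linarith) (by nlinarith [sq_nonneg (1 - 2 * p)])
  rw [← binEntropy_one_sub p]
  exact binEntropy_strictAntiOn.antitoneOn ⟨by simp, hmax.trans (by linarith)⟩
    ⟨by norm_num; linarith, by linarith⟩ hmax

theorem IsGood.eventually_card_le_exp_of_far {C : ∀ n, Code n} {p : I} {ε : ℝ}
    (hC : IsGood p ε C) (hp : (p : ℝ) ≤ 1 / 2) (hε : ε < 1 / 8) (K : ℕ) {η : ℝ} (hη : 0 < η) :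
    ∀ᶠ n : ℕ in atTop, ∀ D : Finset (C n).words, D.card ≤ K →
      (C n).words.card ≤ 4 * (D.biUnion fun d => (C n).farWords (2 * p) d.1).card →
      ((C n).words.card : ℝ) ≤
        exp (n * (binEntropy (max (1 / 2) (3 * p - 4 * p ^ 2)) - binEntropy p + η)) := by
  set r₀ : ℝ := 3 * p - 4 * p ^ 2
  obtain ⟨γ, hγ, hγH⟩ : ∃ γ > 0,
      binEntropy (max (1 / 2) (r₀ - γ)) ≤ binEntropy (max (1 / 2) r₀) + η / 3 := by
    refine exists_pos_le_of_continuous (by fun_prop) ?_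
    rw [sub_zero]
    linarith
  have hr₀1 : r₀ - γ < 1 := by nlinarith [sq_nonneg ((p : ℝ) - 3 / 8)]
  have hhalf : ∀ᶠ n : ℕ in atTop, (1 / 2 : ℝ) ≤ 1 - ((2 * γ) ^ 2)⁻¹ / n :=
    (tendsto_one_sub_const_div_natCast _).eventually_const_le (by norm_num)
  have hη3 : 0 < η / 3 := by positivity
  filter_upwards [eventually_ne_atTop 0, hhalf, eventually_le_exp_natCast_mul K hη3,
    hC.eventually_card_le_mul_exp hp (α := 1 / 4) (τ := 1 / 2) (by norm_num) (by linarith) hη3]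
    with n hn hhalf hK himage D hDK hD
  set T := D.biUnion fun d => Finset.univ.filter fun y => (r₀ - γ) * n ≤ hammingDist d.1 y
  have hD' : 1 / 4 * ((C n).words.card : ℝ) ≤
      (D.biUnion fun d => (C n).farWords (2 * p) d.1).card := by
    rify at hD
    linarith
  have hT : (T.card : ℝ) ≤ K * exp (n * binEntropy (max (1 / 2) (r₀ - γ))) :=
    (card_biUnion_le_hammingDist_le D _ hr₀1).trans (by gcongr)
  have hreach : ∀ x ∈ D.biUnion fun d => (C n).farWords (2 * p) d.1,
      1 / 2 ≤ (bscNoise p n).toMeasure.real {e | x.1 + e ∈ T} := by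
    intro x hx
    obtain ⟨d, hd, hdx⟩ := Finset.mem_biUnion.1 hx
    exact hhalf.trans <| (one_sub_le_bscNoise_toMeasure_real_of_mem_farWords hn hp hdx hγ).trans <|
      measureReal_mono fun e he =>
        Finset.mem_biUnion.2 ⟨d, hd, (Finset.mem_filter_univ _).2 he⟩
  calc ((C n).words.card : ℝ) ≤ T.card * exp (n * (η / 3 - binEntropy p)) := himage _ T hD' hreach
    _ ≤ exp (n * (η / 3)) * exp (n * (binEntropy (max (1 / 2) r₀) + η / 3)) *
          exp (n * (η / 3 - binEntropy p)) := by grw [hT, hK, hγH]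
    _ = exp (n * (binEntropy (max (1 / 2) r₀) - binEntropy p + η)) := by
        rw [← exp_add, ← exp_add]
        ring_nf

theorem IsGood.eventually_card_le_exp {C : ∀ n, Code n} {p : I} {ε : ℝ} (hC : IsGood p ε C)
    (hp : (p : ℝ) ≤ 1 / 2) (hε : ε < 1 / 8) {η : ℝ} (hη : 0 < η) :
    ∀ᶠ n : ℕ in atTop, ((C n).words.card : ℝ) ≤
      exp (n * (binEntropy (max (1 / 2) (3 * p - 4 * p ^ 2)) - binEntropy p + η)) := by
  obtain ⟨δ, hδ0, hδ1, hδ⟩ := hC.exists_eventually_card_centralWords_lt p.2.1 hε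
  obtain ⟨K, hK⟩ := exists_pow_lt_of_lt_one (show (0 : ℝ) < 1 / 2 by norm_num)
    (show 1 - δ < 1 by linarith)
  filter_upwards [hδ, eventually_le_exp_natCast_mul 4 hη,
    hC.eventually_card_le_exp_of_far hp hε K hη]
    with n hδ hfour hfar
  rcases lt_or_ge (C n).words.card 4 with hsmall | hlarge
  · have hH := binEntropy_le_binEntropy_max p.2.1 hp
    calc ((C n).words.card : ℝ) ≤ 4 := mod_cast hsmall.le
      _ ≤ exp (n * η) := hfour
      _ ≤ exp (n * (binEntropy (max (1 / 2) (3 * p - 4 * p ^ 2)) - binEntropy p + η)) := by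
          gcongr
          linarith
  · obtain ⟨D, hDK, hD⟩ :=
      (C n).exists_card_le_four_mul_card_biUnion_farWords hδ1 hK.le (hδ hlarge)
    exact hfar D hDK hD

theorem rate_le_of_card_le_exp {n : ℕ} (hn : n ≠ 0) {C : Code n} {B : ℝ}
    (h : (C.words.card : ℝ) ≤ exp (n * (B * log 2))) : rate C ≤ B := by
  rw [rate, logb, div_div, div_le_iff₀ (by positivity)]
  linarith [(log_le_iff_le_exp C.card_pos).2 h]

theorem strongCapacity_le_of_eventually_card_le_exp {p ε B : ℝ} (hε : 0 < ε)
    (h : ∀ C : ∀ n, Code n, IsGood p ε C → ∀ η : ℝ, 0 < η →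
      ∀ᶠ n : ℕ in atTop, ((C n).words.card : ℝ) ≤ exp (n * (B * log 2 + η))) :
    strongCapacity p ≤ (B : EReal) := by
  refine iInf₂_le_of_le ε hε (iSup₂_le fun C hC => EReal.le_of_forall_lt_iff_le.1 fun b hb => ?_)
  have hbB : B < b := EReal.coe_lt_coe_iff.1 hb
  refine limsup_le_of_le (by isBoundedDefault) ?_
  filter_upwards [eventually_ne_atTop 0,
    h C hC ((b - B) * log 2) (mul_pos (sub_pos.2 hbB) (log_pos one_lt_two))] with n hn hcard
  rw [← add_mul, add_sub_cancel] at hcard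
  exact EReal.coe_le_coe_iff.2 (rate_le_of_card_le_exp hn hcard)

theorem strongCapacity_le {p : ℝ} (h0 : 0 ≤ p) (hp : p ≤ 1 / 2) :
    strongCapacity p ≤ ((hB (max (1 / 2) (3 * p - 4 * p ^ 2)) - hB p : ℝ) : EReal) := by
  refine strongCapacity_le_of_eventually_card_le_exp (ε := 1 / 16) (by norm_num)
    fun C hC η hη => ?_
  have hlog : log 2 ≠ 0 := (log_pos one_lt_two).ne'
  rw [hB, hB, sub_mul, div_mul_cancel₀ _ hlog, div_mul_cancel₀ _ hlog]
  exact IsGood.eventually_card_le_exp (p := ⟨p, h0, by linarith⟩) hC hp (by norm_num) hη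

theorem hB_one_half : hB (1 / 2) = 1 := by
  rw [hB, one_div, binEntropy_two_inv, div_self (log_pos one_lt_two).ne']

theorem hB_one_sub (x : ℝ) : hB (1 - x) = hB x := by
  rw [hB, hB, binEntropy_one_sub]

theorem hB_lt_one {x : ℝ} (hx : x ≠ 1 / 2) : hB x < 1 := by
  rw [hB, div_lt_one (log_pos one_lt_two), binEntropy_lt_log_two, ← one_div]
  exact hx

end CapacityBound

end

theorem theorem2 (p : ℝ) :
    (0 ≤ p → p ≤ 1 / 4 → strongCapacity p ≤ ((1 - hB p : ℝ) : EReal)) ∧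
    (1 / 4 < p → p ≤ 1 / 2 →
      strongCapacity p ≤ ((hB (1 - 3 * p + 4 * p ^ 2) - hB p : ℝ) : EReal)) ∧
    (1 / 4 < p → p < 1 / 2 → hB (1 - 3 * p + 4 * p ^ 2) - hB p < 1 - hB p) := by
  refine ⟨fun h0 h1 => ?_, fun h0 h1 => ?_, fun h0 h1 => ?_⟩
  · have hmax : max (1 / 2) (3 * p - 4 * p ^ 2) = 1 / 2 := max_eq_left (by nlinarith)
    rw [← hB_one_half, ← hmax]
    exact strongCapacity_le h0 (by linarith)
  · have hmax : max (1 / 2) (3 * p - 4 * p ^ 2) = 1 - (1 - 3 * p + 4 * p ^ 2) := by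
      rw [max_eq_right (by nlinarith)]
      ring
    rw [← hB_one_sub, ← hmax]
    exact strongCapacity_le (by linarith) h1
  · exact sub_lt_sub_right (hB_lt_one (by nlinarith)) (hB p)
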